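/- Let $P_S,\sigma^2,d_{SD},R_0,\lambda_1,M>0$ and $\alpha\in\mathbb R$. Let $h_{SD}(i)\sim\mathcal{CN}(0,d_{SD}^{-\alpha})$ and $X(i)\sim\mathrm{Exp}(\lambda_1)$ (mean $1/\lambda_1$), $i=0,1,2,\dots$, and an initial level $B(0)\ge 0$ (of arbitrary law) all be mutually independent. Put $\gamma_{SD}(i)=P_S|h_{SD}(i)|^2/\sigma^2$, $W_2=\sigma^2 d_{SD}^{\alpha}/P_S$, and $\Gamma'_{th}=2^{2R_0}-1$ (incremental signalling) or $\Gamma'_{th}=\infty$ (non-incremental signalling). The infinite-size energy buffer of the relay under the incremental best-effort policy (IBEP) evolves as $$B(i+1)=\begin{cases}B(i)+X(i), & \gamma_{SD}(i)\ge\Gamma'_{th},\\ B(i)-M+X(i), & \gamma_{SD}(i)<\Gamma'_{th},\ B(i)\ge M,\\ X(i), & \gamma_{SD}(i)<\Gamma'_{th},\ B(i)<M,\end{cases}$$ and the relay transmit power is $P_R(i)=\min(B(i),M)/(1/2)$. Suppose that $$\phi_{inc}=M\lambda_1\bigl(1-e^{-W_2\Gamma'_{th}}\bigr)\le 1$$ (with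 $e^{-\infty}=0$). Then: 1. $B(i)$ has no limiting distribution as $i\to\infty$: there is no probability distribution function $G$ on $\mathbb R$ with $\Pr\{B(i)\le x\}\to G(x)$ at every continuity point $x$ of $G$. 2. The energy $M$ is asymptotically almost surely available, $\Pr\{B(i)\ge M\}\to 1$, so that asymptotically the relay transmit power is $2M$ almost surely: $\Pr\{P_R(i)=2M\}\to 1$ and $\Pr\{P_R(i)=2M\mid\gamma_{SD}(i)<\Gamma'_{th}\}\to 1$. 3. Almost surely, the fraction of the intervals $0,\dots,N-1$ in which $B(i)\ge M$ and $P_R(i)=2M$ tends to $1$ as $N\to\infty$. If $\phi_{inc}<1$, then almost surely $B(i)\ge M$ and $P_R(i)=2M$ for all sufficiently large $i$. -/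

import Mathlib

open MeasureTheory ProbabilityTheory Filter Topology
open scoped NNReal ENNReal

/-- The two signalling schemes: in the non-incremental one the destination always sends a
negative acknowledgment (infinite threshold). -/
inductive Signalling where
  | incremental
  | nonIncremental

/-- The deterministic parameters of the energy-buffer-aided relaying link. -/
structure LinkParams where
  /-- source transmit power `P_S` -/
  PS : ℝ
  /-- noise power `σ²` -/
  noise : ℝ
  /-- source-destination distance `d_SD` -/
  dSD : ℝ
  /-- path-loss exponent `α` -/
  pathLoss : ℝ
  /-- target rate `R₀` -/
  R0 : ℝ
  /-- rate `lam1` of the exponential harvested energy, whose mean is `1 / lam1` -/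
  lam1 : ℝ
  /-- energy `M` drawn for a relay transmission -/
  M : ℝ
  /-- incremental or non-incremental signalling -/
  mode : Signalling
  PS_pos : 0 < PS
  noise_pos : 0 < noise
  dSD_pos : 0 < dSD
  R0_pos : 0 < R0
  lam1_pos : 0 < lam1
  M_pos : 0 < M

/-- The circularly symmetric complex Gaussian law `CN(0, v)`: independent real and imaginary
parts, each centred Gaussian of variance `v / 2`. -/
noncomputable def complexGaussian (v : ℝ≥0) : Measure ℂ :=
  ((gaussianReal 0 (v / 2)).prod (gaussianReal 0 (v / 2))).map
    (fun p : ℝ × ℝ => Complex.mk p.1 p.2)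

namespace LinkParams

/-- The threshold `Γ'_th`: it is `2 ^ (2 R₀) - 1` for incremental signalling and `∞` for
non-incremental signalling. -/
noncomputable def threshold (p : LinkParams) : EReal :=
  match p.mode with
  | Signalling.incremental => (((2 : ℝ) ^ (2 * p.R0) - 1 : ℝ) : EReal)
  | Signalling.nonIncremental => ⊤

/-- `W₂ = σ² d_SD ^ α / P_S`. -/
noncomputable def W2 (p : LinkParams) : ℝ := p.noise * p.dSD ^ p.pathLoss / p.PS

/-- `φ_inc = M lam1 (1 - exp (- W₂ Γ'_th))`, with `exp (-∞) = 0`. -/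
noncomputable def phiInc (p : LinkParams) : ℝ :=
  p.M * p.lam1 * (1 - (EReal.exp (-((p.W2 : EReal) * p.threshold))).toReal)

/-- The variance `d_SD ^ (-α)` of the source-destination channel. -/
noncomputable def channelVar (p : LinkParams) : ℝ≥0 := (p.dSD ^ (-p.pathLoss)).toNNReal

/-- The instantaneous source-destination SNR `γ_SD = P_S |h|² / σ²`. -/
noncomputable def snr (p : LinkParams) (h : ℂ) : ℝ := p.PS * ‖h‖ ^ 2 / p.noise

/-- A negative acknowledgment is sent: `γ_SD < Γ'_th`. -/
def Nack (p : LinkParams) (h : ℂ) : Prop := (p.snr h : EReal) < p.threshold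

open Classical in
/-- One step of the infinite-size buffer under the incremental best-effort policy (IBEP):
`b` is the current level, `x` the harvested energy, `h` the source-destination channel. -/
noncomputable def ibepStep (p : LinkParams) (b x : ℝ) (h : ℂ) : ℝ :=
  if ¬ p.Nack h then b + x
  else if p.M ≤ b then b - p.M + x
  else x

/-- The buffer level `B(i)` under IBEP, started from `B(0) = B0`. -/
noncomputable def buffer {Ω : Type*} (p : LinkParams) (B0 : Ω → ℝ) (X : ℕ → Ω → ℝ)
    (h : ℕ → Ω → ℂ) : ℕ → Ω → ℝ
  | 0 => B0
  | i + 1 => fun ω => p.ibepStep (buffer p B0 X h i ω) (X i ω) (h i ω)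

/-- The relay transmit power at buffer level `b`: the energy `min b M` is spent in a phase of
duration `1 / 2`. -/
noncomputable def relayPower (p : LinkParams) (b : ℝ) : ℝ := min b p.M / (1 / 2)

end LinkParams

/-- The probabilistic model: the harvested energies `X i` are exponential with rate `lam1`, the
channels `h i` are `CN(0, d_SD ^ (-α))`, the initial level `B0` is nonnegative, and all these
random variables are mutually independent. -/
structure LinkModel {Ω : Type*} [MeasurableSpace Ω] (μ : Measure Ω) (p : LinkParams)
    (B0 : Ω → ℝ) (X : ℕ → Ω → ℝ) (h : ℕ → Ω → ℂ) : Prop where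
  measurable_B0 : Measurable B0
  measurable_X : ∀ i, Measurable (X i)
  measurable_h : ∀ i, Measurable (h i)
  B0_nonneg : ∀ᵐ ω ∂μ, 0 ≤ B0 ω
  law_X : ∀ i, μ.map (X i) = expMeasure p.lam1
  law_h : ∀ i, μ.map (h i) = complexGaussian p.channelVar
  indep_X_h : ∀ i, IndepFun (X i) (h i) μ
  indep_intervals : iIndepFun (fun i ω => (X i ω, h i ω)) μ
  indep_B0 : IndepFun B0 (fun ω i => (X i ω, h i ω)) μ

/-- The sequence `B i` has a limiting distribution: for some probability law `π`, the CDFs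
`Pr {B i ≤ x}` converge to the CDF of `π` at each of its continuity points `x`. -/
def HasLimitingDistribution {Ω : Type*} [MeasurableSpace Ω] (μ : Measure Ω)
    (B : ℕ → Ω → ℝ) : Prop :=
  ∃ π : Measure ℝ, IsProbabilityMeasure π ∧
    ∀ x : ℝ, ContinuousAt (fun y : ℝ => π.real (Set.Iic y)) x →
      Tendsto (fun i => μ.real {ω | B i ω ≤ x}) atTop (𝓝 (π.real (Set.Iic x)))

open Classical in
/-- The fraction of the first `N` signalling intervals `i = 0, …, N - 1` in which `s i` holds. -/
noncomputable def timeFraction (s : ℕ → Prop) (N : ℕ) : ℝ :=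
  (((Finset.range N).filter s).card : ℝ) / N

/-!
The buffer obeys `B (i + 1) = max (B i - D i) 0 + X i`, where the demand `D i` is `M` after a
negative acknowledgment and `0` otherwise. The condition `φ_inc ≤ 1` says that the mean net input
`E X - M * Pr {NACK}` is nonnegative. A buffer started at `B 0 ≥ 0` stays above the one started
empty, so everything is proved for the latter, which is a function of the i.i.d. inputs
`(X i, h i)`.

*Frequencies.* The level minus the unreflected walk of net inputs is the accumulated shortage. It
grows only while the level is below `M`, and the walk is eventually above `-ε n` by the strong law,
so the shortage is `o(n)` almost surely (`LinkParams.tendsto_shortage_div`). Every negative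
acknowledgment at a level of at most `M / 2` adds at least `M / 2` to it, so such intervals have
frequency zero. To remove the condition on the acknowledgment, which is independent of the past,
`tendsto_frequency_zero_of_thinned` is used: a predictable set of times has frequency zero if a
thinning of it, with fixed positive probability and independent of the past, has. This follows from
an exponential martingale, Markov's inequality and the Borel-Cantelli lemma. A second thinning, by
negative acknowledgments with an input of at most `M / 2` (which lead from below `M` to at most
`M / 2`), gives frequency zero to the level being below `M`. The critical case `φ_inc = 1` needs no
separate treatment.

*Probabilities.* The law of the buffer started empty increases stochastically in time
(`LinkModel.antitone_measureReal_buffer_zero_le`), since discarding the first input only lowers it.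
Hence `Pr {B i ≤ M / 2}` is antitone; its averages tend to zero by dominated convergence, so the
terms do. As the level drops by `M / 2` in one interval with fixed positive probability, the same
holds for `Pr {B i ≤ K}` for every `K`, which excludes a limiting distribution. For `φ_inc < 1` the
walk itself, which bounds the level from below, tends to infinity almost surely.
-/

/-! ### Laws of the harvested energy and of the channel -/

lemma ae_nonneg_expMeasure (r : ℝ) : ∀ᵐ x ∂expMeasure r, 0 ≤ x := by
  have h0 : gammaMeasure 1 r (Set.Iio 0) = 0 := by
    rw [gammaMeasure, withDensity_apply _ measurableSet_Iio]
    exact lintegral_gammaPDF_of_nonpos le_rfl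
  rw [ae_iff, expMeasure]
  convert h0 using 2
  ext x
  simp

/-- The identity `x * gammaPDF 1 r x = r⁻¹ * gammaPDF 2 r x` reduces the mean of the exponential
law to the total mass of a Gamma law. -/
lemma lintegral_ofReal_expMeasure {r : ℝ} (hr : 0 < r) :
    ∫⁻ x, ENNReal.ofReal x ∂expMeasure r = ENNReal.ofReal (1 / r) := by
  have hm : Measurable (gammaPDF 1 r) := (measurable_gammaPDFReal 1 r).ennreal_ofReal
  have hm2 : Measurable (gammaPDF 2 r) := (measurable_gammaPDFReal 2 r).ennreal_ofReal
  rw [expMeasure, gammaMeasure,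
    lintegral_withDensity_eq_lintegral_mul _ hm ENNReal.measurable_ofReal]
  have key : ∀ x, (gammaPDF 1 r * fun x => ENNReal.ofReal x) x
      = ENNReal.ofReal (1 / r) * gammaPDF 2 r x := by
    intro x
    rcases lt_or_ge x 0 with hx | hx
    · simp [gammaPDF_of_neg hx]
    · rw [Pi.mul_apply, gammaPDF_of_nonneg hx, gammaPDF_of_nonneg hx,
        ← ENNReal.ofReal_mul' hx, ← ENNReal.ofReal_mul (by positivity)]
      congr 1
      have : (2 : ℝ) - 1 = 1 := by norm_num
      rw [this]
      simp
      field_simp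
  rw [lintegral_congr key, lintegral_const_mul _ hm2,
    lintegral_gammaPDF_eq_one (by norm_num) hr, mul_one]

lemma integrable_id_expMeasure {r : ℝ} (hr : 0 < r) : Integrable (fun x => x) (expMeasure r) := by
  refine ⟨measurable_id.aestronglyMeasurable, ?_⟩
  rw [hasFiniteIntegral_iff_ofReal (ae_nonneg_expMeasure r), lintegral_ofReal_expMeasure hr]
  exact ENNReal.ofReal_lt_top

lemma integral_id_expMeasure {r : ℝ} (hr : 0 < r) : ∫ x, x ∂expMeasure r = 1 / r := by
  rw [integral_eq_lintegral_of_nonneg_ae (ae_nonneg_expMeasure r)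
    measurable_id.aestronglyMeasurable, lintegral_ofReal_expMeasure hr,
    ENNReal.toReal_ofReal (by positivity)]

lemma expMeasure_real_Iic {r : ℝ} (hr : 0 < r) {x : ℝ} (hx : 0 ≤ x) :
    (expMeasure r).real (Set.Iic x) = 1 - Real.exp (-(r * x)) := by
  have := isProbabilityMeasure_expMeasure hr
  rw [← cdf_eq_real, cdf_expMeasure_eq hr, if_pos hx]

lemma measurable_complex_mk : Measurable (fun p : ℝ × ℝ => Complex.mk p.1 p.2) :=
  Complex.measurableEquivRealProd.symm.measurable

instance (v : ℝ≥0) : IsProbabilityMeasure (complexGaussian v) :=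
  Measure.isProbabilityMeasure_map measurable_complex_mk.aemeasurable

lemma gaussianPDF_mul_gaussianPDF (v : ℝ≥0) (x y : ℝ) :
    gaussianPDF 0 (v / 2) x * gaussianPDF 0 (v / 2) y
      = ENNReal.ofReal ((Real.pi * v)⁻¹ * Real.exp (-(x ^ 2 + y ^ 2) / v)) := by
  rw [gaussianPDF, gaussianPDF, ← ENNReal.ofReal_mul (gaussianPDFReal_nonneg _ _ _),
    gaussianPDFReal, gaussianPDFReal]
  congr 1
  have h2 : 2 * Real.pi * ((v / 2 : ℝ≥0) : ℝ) = Real.pi * v := by push_cast; ring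
  have h3 : 2 * ((v / 2 : ℝ≥0) : ℝ) = v := by push_cast; ring
  rw [h2, h3, mul_mul_mul_comm, ← mul_inv, Real.mul_self_sqrt (by positivity), ← Real.exp_add]
  congr 2
  ring

lemma integral_mul_exp_neg_sq_div {v : ℝ} (hv : 0 < v) (s : ℝ) :
    ∫ r in (0 : ℝ)..s, r * ((Real.pi * v)⁻¹ * Real.exp (-r ^ 2 / v))
      = (1 - Real.exp (-s ^ 2 / v)) / (2 * Real.pi) := by
  have hd : ∀ r ∈ Set.uIcc 0 s, HasDerivAt
      (fun r : ℝ => -(Real.exp (-r ^ 2 / v)) / (2 * Real.pi))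
      (r * ((Real.pi * v)⁻¹ * Real.exp (-r ^ 2 / v))) r := by
    intro r _
    have h1 : HasDerivAt (fun r : ℝ => -r ^ 2 / v) (-(2 * r) / v) r := by
      simpa using ((hasDerivAt_pow 2 r).fun_neg).div_const v
    convert! (h1.exp.fun_neg).div_const (2 * Real.pi) using 1
    field_simp
  rw [intervalIntegral.integral_eq_sub_of_hasDerivAt hd]
  · simp
    ring
  · exact (by fun_prop : Continuous fun r : ℝ =>
      r * ((Real.pi * v)⁻¹ * Real.exp (-r ^ 2 / v))).intervalIntegrable _ _

/-- If `h` has the law `CN(0, v)`, then `‖h‖ ^ 2` is exponential of mean `v`; the proof integrates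
the Gaussian density in polar coordinates. -/
lemma complexGaussian_real_norm_sq_lt {v : ℝ≥0} (hv : v ≠ 0) {t : ℝ} (ht : 0 ≤ t) :
    (complexGaussian v).real {z | ‖z‖ ^ 2 < t} = 1 - Real.exp (-t / v) := by
  have hv' : (0 : ℝ) < v := by positivity
  have hv2 : v / 2 ≠ 0 := by positivity
  set s := Real.sqrt t with hs
  have hs0 : 0 ≤ s := Real.sqrt_nonneg t
  have hst : s ^ 2 = t := Real.sq_sqrt ht
  have hpre : (fun p : ℝ × ℝ => Complex.mk p.1 p.2) ⁻¹' {z | ‖z‖ ^ 2 < t}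
      = {p : ℝ × ℝ | p.1 ^ 2 + p.2 ^ 2 < t} := by
    ext p
    simp [Complex.sq_norm, Complex.normSq_apply, ← sq]
  have hmeas : MeasurableSet {p : ℝ × ℝ | p.1 ^ 2 + p.2 ^ 2 < t} :=
    measurableSet_lt (by fun_prop) measurable_const
  have hmeas' : MeasurableSet {z : ℂ | ‖z‖ ^ 2 < t} :=
    measurableSet_lt (by fun_prop) measurable_const
  have hg : Measurable (gaussianPDF 0 (v / 2)) := measurable_gaussianPDF 0 (v / 2)
  have hint0 : 0 ≤ ∫ r in (0 : ℝ)..s, r * ((Real.pi * v)⁻¹ * Real.exp (-r ^ 2 / v)) :=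
    intervalIntegral.integral_nonneg hs0 fun r hr => by have := hr.1; positivity
  have hkey : complexGaussian v {z | ‖z‖ ^ 2 < t} = ENNReal.ofReal (1 - Real.exp (-t / v)) := by
    rw [complexGaussian, Measure.map_apply measurable_complex_mk hmeas', hpre,
      gaussianReal_of_var_ne_zero _ hv2, prod_withDensity hg hg,
      withDensity_apply _ hmeas, ← lintegral_indicator hmeas]
    simp_rw [gaussianPDF_mul_gaussianPDF]
    rw [← Measure.volume_eq_prod, ← lintegral_comp_polarCoord_symm]
    have hrad : ∀ p ∈ polarCoord.target, ENNReal.ofReal p.1 •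
        ({p : ℝ × ℝ | p.1 ^ 2 + p.2 ^ 2 < t}.indicator (fun p =>
          ENNReal.ofReal ((Real.pi * v)⁻¹ * Real.exp (-(p.1 ^ 2 + p.2 ^ 2) / v)))
            (polarCoord.symm p))
        = (Set.Iio s).indicator (fun r =>
          ENNReal.ofReal (r * ((Real.pi * v)⁻¹ * Real.exp (-r ^ 2 / v)))) p.1 * 1 := by
      rintro ⟨r, θ⟩ hp
      have hr : 0 < r := hp.1
      have hsq : (r * Real.cos θ) ^ 2 + (r * Real.sin θ) ^ 2 = r ^ 2 := by
        rw [mul_pow, mul_pow, ← mul_add, Real.cos_sq_add_sin_sq, mul_one]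
      have hiff : r ^ 2 < t ↔ r < s := by
        rw [← hst]; exact pow_lt_pow_iff_left₀ hr.le hs0 two_ne_zero
      by_cases hrs : r < s
      · simp [Set.indicator, hsq, hiff, hrs, ENNReal.ofReal_mul hr.le]
      · simp [Set.indicator, hsq, hiff, hrs]
    have hmr : Measurable ((Set.Iio s).indicator (fun r =>
          ENNReal.ofReal (r * ((Real.pi * v)⁻¹ * Real.exp (-r ^ 2 / v))))) :=
      Measurable.indicator (by fun_prop) measurableSet_Iio
    rw [setLIntegral_congr_fun polarCoord.open_target.measurableSet hrad, polarCoord_target,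
      Measure.volume_eq_prod, ← Measure.prod_restrict,
      lintegral_prod_mul hmr.aemeasurable aemeasurable_const,
      setLIntegral_indicator measurableSet_Iio]
    have hset : (volume : Measure ℝ).restrict (Set.Iio s ∩ Set.Ioi 0)
        = volume.restrict (Set.Ioc 0 s) := by
      rw [Set.inter_comm, Set.Ioi_inter_Iio]
      exact Measure.restrict_congr_set Ioo_ae_eq_Ioc
    rw [hset, ← ofReal_integral_eq_lintegral_ofReal,
      ← intervalIntegral.integral_of_le hs0, lintegral_one, Measure.restrict_apply_univ,
      Real.volume_Ioo, ← ENNReal.ofReal_mul hint0, integral_mul_exp_neg_sq_div hv', hst]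
    · congr 1
      field_simp
      ring
    · exact (intervalIntegrable_iff_integrableOn_Ioc_of_le hs0).1
        ((by fun_prop : Continuous fun r : ℝ =>
          r * ((Real.pi * v)⁻¹ * Real.exp (-r ^ 2 / v))).intervalIntegrable _ _)
    · filter_upwards [ae_restrict_mem measurableSet_Ioc] with r hr
      have := hr.1
      simp only [Pi.zero_apply]
      positivity
  rw [measureReal_def, hkey, ENNReal.toReal_ofReal]
  have : Real.exp (-t / v) ≤ 1 := Real.exp_le_one_iff.2 (by
    rw [neg_div]; have : 0 ≤ t / v := by positivity
    linarith)
  linarith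

namespace LinkParams

variable (p : LinkParams)

lemma W2_pos : 0 < p.W2 := by
  have := p.PS_pos; have := p.noise_pos; have := p.dSD_pos
  unfold W2
  positivity

lemma threshold_pos : 0 < p.threshold := by
  unfold threshold
  cases p.mode with
  | incremental =>
    have : (1 : ℝ) < 2 ^ (2 * p.R0) :=
      Real.one_lt_rpow (by norm_num) (by have := p.R0_pos; positivity)
    have h' : (0 : ℝ) < 2 ^ (2 * p.R0) - 1 := sub_pos.2 this
    exact EReal.coe_pos.2 h'
  | nonIncremental => simp

/-- The probability `1 - exp (-W₂ Γ'_th)` of a negative acknowledgment. -/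
noncomputable def nackProb : ℝ := 1 - (EReal.exp (-((p.W2 : EReal) * p.threshold))).toReal

lemma phiInc_eq : p.phiInc = p.M * p.lam1 * p.nackProb := rfl

lemma channelVar_coe : (p.channelVar : ℝ) = p.dSD ^ (-p.pathLoss) :=
  Real.coe_toNNReal _ (Real.rpow_nonneg p.dSD_pos.le _)

lemma channelVar_ne_zero : p.channelVar ≠ 0 := by
  have h : (0 : ℝ) < p.channelVar := by
    rw [channelVar_coe]; exact Real.rpow_pos_of_pos p.dSD_pos _
  exact_mod_cast h.ne'

lemma measurableSet_nack : MeasurableSet {z : ℂ | p.Nack z} := by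
  unfold Nack snr
  exact measurableSet_lt (Measurable.coe_real_ereal (by fun_prop)) measurable_const

lemma complexGaussian_real_nack :
    (complexGaussian p.channelVar).real {z | p.Nack z} = p.nackProb := by
  have hP := p.PS_pos; have hn := p.noise_pos; have hd := p.dSD_pos
  rcases hm : p.mode with _ | _
  · have hth : p.threshold = (((2 : ℝ) ^ (2 * p.R0) - 1 : ℝ) : EReal) := by
      simp [threshold, hm]
    set c : ℝ := (2 : ℝ) ^ (2 * p.R0) - 1 with hc
    have hc0 : 0 < c := by have := p.threshold_pos; rw [hth] at this; exact_mod_cast this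
    have hset : {z : ℂ | p.Nack z} = {z | ‖z‖ ^ 2 < c * p.noise / p.PS} := by
      ext z
      simp only [Nack, hth, snr, Set.mem_ofPred_eq, EReal.coe_lt_coe_iff]
      rw [div_lt_iff₀ hn, lt_div_iff₀ hP, mul_comm]
    rw [hset, complexGaussian_real_norm_sq_lt p.channelVar_ne_zero (by positivity), nackProb, hth,
      ← EReal.coe_mul, ← EReal.coe_neg, EReal.exp_coe, ENNReal.toReal_ofReal (Real.exp_nonneg _),
      channelVar_coe, W2, Real.rpow_neg hd.le]
    congr 2
    field_simp
  · have hth : p.threshold = ⊤ := by simp [threshold, hm]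
    have hset : {z : ℂ | p.Nack z} = Set.univ := by
      ext z
      simp [Nack, hth]
    rw [hset, nackProb, hth, EReal.coe_mul_top_of_pos p.W2_pos]
    simp

lemma nackProb_pos : 0 < p.nackProb := by
  have hW := p.W2_pos
  have hth := p.threshold_pos
  have hlt : -((p.W2 : EReal) * p.threshold) < 0 := by
    have : 0 < (p.W2 : EReal) * p.threshold := EReal.mul_pos (by exact_mod_cast hW) hth
    simpa using EReal.neg_lt_neg_iff.2 this
  have h1 : EReal.exp (-((p.W2 : EReal) * p.threshold)) < 1 := by
    simpa using EReal.exp_lt_exp_iff.2 hlt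
  have h2 : (EReal.exp (-((p.W2 : EReal) * p.threshold))).toReal < 1 := by
    simpa using (ENNReal.toReal_lt_toReal (h1.trans ENNReal.one_lt_top).ne ENNReal.one_ne_top).2 h1
  unfold nackProb
  linarith

end LinkParams

/-! ### Thinning by events independent of the past -/

/-- The number of indices `i < n` with `ω ∈ s i`, as a real number. -/
noncomputable def visits {Ω : Type*} (s : ℕ → Set Ω) (n : ℕ) (ω : Ω) : ℝ :=
  ∑ i ∈ Finset.range n, (s i).indicator (fun _ => (1 : ℝ)) ω

section Visits

variable {Ω : Type*} (s : ℕ → Set Ω) (n : ℕ) (ω : Ω)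

lemma visits_zero : visits s 0 ω = 0 := by simp [visits]

lemma visits_succ :
    visits s (n + 1) ω = visits s n ω + (s n).indicator (fun _ => (1 : ℝ)) ω :=
  Finset.sum_range_succ _ _

lemma visits_nonneg : 0 ≤ visits s n ω :=
  Finset.sum_nonneg fun _ _ => Set.indicator_nonneg (fun _ _ => zero_le_one) _

lemma visits_le : visits s n ω ≤ n := by
  calc visits s n ω ≤ ∑ i ∈ Finset.range n, (1 : ℝ) :=
        Finset.sum_le_sum fun i _ => Set.indicator_le_self' (fun _ _ => zero_le_one) _
    _ = n := by simp

lemma visits_measurable {m : MeasurableSpace Ω} {s : ℕ → Set Ω} {n : ℕ}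
    (hs : ∀ i < n, MeasurableSet[m] (s i)) : Measurable[m] (visits s n) :=
  Finset.measurable_fun_sum _ fun i hi =>
    measurable_const.indicator (hs i (Finset.mem_range.1 hi))

end Visits

/-- The σ-algebra generated by `Z 0, …, Z (n - 1)`. -/
abbrev past {Ω α : Type*} [MeasurableSpace α] (Z : ℕ → Ω → α) (n : ℕ) : MeasurableSpace Ω :=
  ⨆ j ∈ Set.Iio n, MeasurableSpace.comap (Z j) inferInstance

section Past

variable {Ω α : Type*} [mα : MeasurableSpace α] {Z : ℕ → Ω → α}

lemma past_mono {m n : ℕ} (h : m ≤ n) : past Z m ≤ past Z n :=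
  biSup_mono fun _ hj => lt_of_lt_of_le hj h

lemma measurable_past {j n : ℕ} (h : j < n) : Measurable[past Z n] (Z j) :=
  (comap_measurable (Z j)).mono
    (le_biSup (fun j => MeasurableSpace.comap (Z j) mα) (Set.mem_Iio.2 h)) le_rfl

variable [mΩ : MeasurableSpace Ω] {μ : Measure Ω}

lemma past_le (hZ : ∀ i, Measurable (Z i)) (n : ℕ) : past Z n ≤ mΩ :=
  iSup₂_le fun j _ => (hZ j).comap_le

lemma indep_past (hZ : ∀ i, Measurable (Z i)) (hind : iIndepFun Z μ) (n : ℕ) :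
    Indep (past Z n) (MeasurableSpace.comap (Z n) mα) μ := by
  have h := indep_iSup_of_disjoint (fun i => (hZ i).comap_le) ((iIndepFun_iff_iIndep _ _ _).1 hind)
    (S := Set.Iio n) (T := {n}) (by simp)
  simpa [past] using h

lemma measure_inter_of_past (hZ : ∀ i, Measurable (Z i)) (hind : iIndepFun Z μ) {n : ℕ}
    {E : Set Ω} (hE : MeasurableSet[past Z n] E) {A : Set α} (hA : MeasurableSet A) :
    μ.real (E ∩ Z n ⁻¹' A) = μ.real E * μ.real (Z n ⁻¹' A) := by
  have h := (Indep_iff _ _ μ).1 (indep_past hZ hind n) E (Z n ⁻¹' A) hE ⟨A, hA, rfl⟩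
  simp [measureReal_def, h]

variable [IsProbabilityMeasure μ] {E : ℕ → Set Ω} {A : Set α} {δ : ℝ}

/-- The exponential martingale of the thinned process: if `E i` depends on the past only and
`{Z i ∈ A}` has probability `δ`, then `exp (β * #E - #(E ∩ {Z ∈ A}))` has mean one for
`exp (-β) = 1 - δ * (1 - exp (-1))`. -/
lemma lintegral_exp_visits (hZ : ∀ i, Measurable (Z i)) (hind : iIndepFun Z μ)
    (hA : MeasurableSet A) (hE : ∀ i, MeasurableSet[past Z i] (E i))
    (hδ : ∀ i, μ.real (Z i ⁻¹' A) = δ) {β : ℝ}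
    (hβ : Real.exp (-β) = 1 - δ * (1 - Real.exp (-1))) (n : ℕ) :
    ∫⁻ ω, ENNReal.ofReal (Real.exp
      (β * visits E n ω - visits (fun i => E i ∩ Z i ⁻¹' A) n ω)) ∂μ = 1 := by
  induction n with
  | zero => simp [visits_zero]
  | succ n ih =>
    set W : Ω → ℝ≥0∞ := fun ω => ENNReal.ofReal (Real.exp
      (β * visits E n ω - visits (fun i => E i ∩ Z i ⁻¹' A) n ω)) with hW
    -- the factor contributed by index `n` on the event `E n`
    set g : Ω → ℝ≥0∞ := fun ω => ENNReal.ofReal (Real.exp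
      (β - (Z n ⁻¹' A).indicator (fun _ => (1 : ℝ)) ω)) with hg
    have hle := past_le hZ n
    have hEm := hle _ (hE n)
    have hWm : Measurable[past Z n] W := by
      have h1 : Measurable[past Z n] (visits E n) :=
        visits_measurable fun i hi => past_mono hi.le _ (hE i)
      have h2 : Measurable[past Z n] (visits (fun i => E i ∩ Z i ⁻¹' A) n) :=
        visits_measurable fun i hi =>
          (past_mono hi.le _ (hE i)).inter (measurable_past hi hA)
      exact (Real.measurable_exp.comp ((h1.const_mul β).sub h2)).ennreal_ofReal
    have hgm : Measurable[MeasurableSpace.comap (Z n) mα] g :=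
      (Real.measurable_exp.comp (measurable_const.sub
        (measurable_const.indicator (comap_measurable (Z n) hA)))).ennreal_ofReal
    have hAm : MeasurableSet (Z n ⁻¹' A) := hZ n hA
    have hg1 : ∫⁻ ω, g ω ∂μ = 1 := by
      have hpt : ∀ ω, Real.exp (β - (Z n ⁻¹' A).indicator (fun _ => (1 : ℝ)) ω)
          = Real.exp β - Real.exp β * (1 - Real.exp (-1)) *
            (Z n ⁻¹' A).indicator (fun _ => (1 : ℝ)) ω := by
        intro ω
        by_cases h : ω ∈ Z n ⁻¹' A
        · rw [Set.indicator_of_mem h, sub_eq_add_neg, Real.exp_add]; ring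
        · rw [Set.indicator_of_notMem h]; simp
      have hi : Integrable ((Z n ⁻¹' A).indicator (fun _ => (1 : ℝ))) μ :=
        (integrable_const 1).indicator hAm
      have hint : ∫ ω, Real.exp (β - (Z n ⁻¹' A).indicator (fun _ => (1 : ℝ)) ω) ∂μ = 1 := by
        simp_rw [hpt]
        rw [integral_sub (integrable_const _) (hi.const_mul _), integral_const_mul,
          integral_indicator_const _ hAm, hδ]
        simp only [integral_const, probReal_univ, smul_eq_mul, mul_one, one_mul]
        have : Real.exp β * Real.exp (-β) = 1 := by rw [← Real.exp_add]; simp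
        rw [hβ] at this
        linarith
      rw [hg, ← ofReal_integral_eq_lintegral_ofReal, hint, ENNReal.ofReal_one]
      · simp_rw [hpt]
        exact (integrable_const _).sub (hi.const_mul _)
      · exact ae_of_all _ fun ω => Real.exp_nonneg _
    have hstep : ∀ ω, ENNReal.ofReal (Real.exp (β * visits E (n + 1) ω
        - visits (fun i => E i ∩ Z i ⁻¹' A) (n + 1) ω))
        = (E n)ᶜ.indicator W ω + (E n).indicator W ω * g ω := by
      intro ω
      rw [visits_succ, visits_succ]
      by_cases h : ω ∈ E n
      · have h' : ω ∉ (E n)ᶜ := by simpa using h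
        rw [Set.indicator_of_notMem h', Set.indicator_of_mem h, Set.indicator_of_mem h, zero_add,
          hW, hg, ← ENNReal.ofReal_mul (Real.exp_nonneg _), ← Real.exp_add]
        congr 2
        have : (E n ∩ Z n ⁻¹' A).indicator (fun _ => (1 : ℝ)) ω
            = (Z n ⁻¹' A).indicator (fun _ => (1 : ℝ)) ω := by
          by_cases ha : ω ∈ Z n ⁻¹' A
          · rw [Set.indicator_of_mem ha, Set.indicator_of_mem (Set.mem_inter h ha)]
          · rw [Set.indicator_of_notMem ha, Set.indicator_of_notMem fun h' => ha h'.2]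
        rw [this]
        ring
      · rw [Set.indicator_of_notMem h, Set.indicator_of_notMem h,
          Set.indicator_of_notMem (s := E n ∩ Z n ⁻¹' A) fun h' => h h'.1,
          Set.indicator_of_mem (s := (E n)ᶜ) h]
        simp [hW]
    have hWm' : Measurable W := hWm.mono hle le_rfl
    rw [lintegral_congr hstep, lintegral_add_left (hWm'.indicator hEm.compl),
      lintegral_mul_eq_lintegral_mul_lintegral_of_independent_measurableSpace hle
        (hZ n).comap_le (indep_past hZ hind n) (hWm.indicator (hE n)) hgm,
      hg1, mul_one, lintegral_indicator hEm.compl, lintegral_indicator hEm, add_comm,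
      lintegral_add_compl _ hEm, ih]

/-- If a predictable sequence of events `E i` is thinned by events `{Z i ∈ A}` of fixed positive
probability, independent of the past, and the thinned events have frequency zero, then so have the
events `E i` themselves. -/
lemma tendsto_frequency_zero_of_thinned (hZ : ∀ i, Measurable (Z i)) (hind : iIndepFun Z μ)
    (hA : MeasurableSet A) (hE : ∀ i, MeasurableSet[past Z i] (E i)) (hδ0 : 0 < δ)
    (hδ : ∀ i, μ.real (Z i ⁻¹' A) = δ)
    (hthin : ∀ᵐ ω ∂μ,
      Tendsto (fun n : ℕ => visits (fun i => E i ∩ Z i ⁻¹' A) n ω / n) atTop (𝓝 0)) :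
    ∀ᵐ ω ∂μ, Tendsto (fun n : ℕ => visits E n ω / n) atTop (𝓝 0) := by
  have hδ1 : δ ≤ 1 := by rw [← hδ 0]; exact measureReal_le_one
  have he0 : 0 < Real.exp (-1) := Real.exp_pos _
  have he1 : Real.exp (-1) < 1 := Real.exp_lt_one_iff.2 (by norm_num)
  have hq0 : 0 < 1 - δ * (1 - Real.exp (-1)) := by nlinarith
  have hq1 : 1 - δ * (1 - Real.exp (-1)) < 1 := by nlinarith
  set β : ℝ := -Real.log (1 - δ * (1 - Real.exp (-1))) with hβdef
  have hβ : Real.exp (-β) = 1 - δ * (1 - Real.exp (-1)) := by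
    rw [hβdef, neg_neg, Real.exp_log hq0]
  have hβ0 : 0 < β := neg_pos.2 (Real.log_neg hq0 hq1)
  have hmean := lintegral_exp_visits hZ hind hA hE hδ hβ
  -- Markov's inequality and the Borel-Cantelli lemma bound the exponent by `ε * n`
  have hBC : ∀ k : ℕ, ∀ᵐ ω ∂μ, ∀ᶠ n : ℕ in atTop,
      β * visits E n ω - visits (fun i => E i ∩ Z i ⁻¹' A) n ω ≤ (1 / (k + 1) : ℝ) * n := by
    intro k
    set ε : ℝ := 1 / (k + 1) with hε
    have hε0 : 0 < ε := by positivity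
    have hmarkov : ∀ n : ℕ, μ {ω | ENNReal.ofReal (Real.exp (ε * n)) ≤ ENNReal.ofReal (Real.exp
        (β * visits E n ω - visits (fun i => E i ∩ Z i ⁻¹' A) n ω))}
        ≤ ENNReal.ofReal (Real.exp (-ε)) ^ n := by
      intro n
      have hm1 : Measurable (visits E n) :=
        visits_measurable fun i _ => past_le hZ i _ (hE i)
      have hm2 : Measurable (visits (fun i => E i ∩ Z i ⁻¹' A) n) :=
        visits_measurable fun i _ => (past_le hZ i _ (hE i)).inter (hZ i hA)
      refine (meas_ge_le_lintegral_div (Real.measurable_exp.comp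
        ((hm1.const_mul β).sub hm2)).ennreal_ofReal.aemeasurable
        (by simpa using Real.exp_pos _) ENNReal.ofReal_ne_top).trans ?_
      rw [← ENNReal.ofReal_pow (Real.exp_nonneg _), ← Real.exp_nat_mul]
      simp only [Function.comp_apply, Pi.sub_apply, hmean]
      rw [one_div, ← ENNReal.ofReal_inv_of_pos (Real.exp_pos _), ← Real.exp_neg]
      apply le_of_eq
      congr 2
      ring
    have hsum : ∑' n : ℕ, μ {ω | ENNReal.ofReal (Real.exp (ε * n)) ≤ ENNReal.ofReal (Real.exp
        (β * visits E n ω - visits (fun i => E i ∩ Z i ⁻¹' A) n ω))} ≠ ∞ := by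
      refine ne_top_of_le_ne_top ?_ (ENNReal.tsum_le_tsum hmarkov)
      rw [ENNReal.tsum_geometric]
      refine ENNReal.inv_ne_top.2 (tsub_pos_of_lt ?_).ne'
      rw [← ENNReal.ofReal_one]
      exact (ENNReal.ofReal_lt_ofReal_iff one_pos).2 (Real.exp_lt_one_iff.2 (by linarith))
    filter_upwards [ae_eventually_notMem hsum] with ω hω
    filter_upwards [hω] with n hn
    simp only [not_le] at hn
    exact (Real.exp_lt_exp.1 ((ENNReal.ofReal_lt_ofReal_iff (Real.exp_pos _)).1 hn)).le
  filter_upwards [ae_all_iff.2 hBC, hthin] with ω hω hthin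
  rw [Metric.tendsto_atTop'] at hthin ⊢
  intro ε hε
  obtain ⟨k, hk⟩ := exists_nat_one_div_lt (show 0 < β * ε / 2 by positivity)
  obtain ⟨N, hN⟩ := hthin (β * ε / 2) (by positivity)
  obtain ⟨N', hN'⟩ := eventually_atTop.1 (hω k)
  refine ⟨max N N', fun n hn => ?_⟩
  have hn0 : 0 < (n : ℝ) := by exact_mod_cast (Nat.zero_le _).trans_lt hn
  have h1 := hN n (lt_of_le_of_lt (le_max_left _ _) hn)
  have h2 := hN' n ((le_max_right _ _).trans hn.le)
  rw [Real.dist_eq, sub_zero, 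
    abs_of_nonneg (div_nonneg (visits_nonneg _ _ _) hn0.le), div_lt_iff₀ hn0] at h1
  rw [Real.dist_eq, sub_zero, abs_of_nonneg (div_nonneg (visits_nonneg _ _ _) hn0.le),
    div_lt_iff₀ hn0]
  have h3 := mul_lt_mul_of_pos_right hk hn0
  nlinarith

end Past

/-! ### One step of the buffer and comparison of buffers -/

namespace LinkParams

variable (p : LinkParams)

lemma ibepStep_nonneg {b x : ℝ} (hb : 0 ≤ b) (hx : 0 ≤ x) (z : ℂ) : 0 ≤ p.ibepStep b x z := by
  unfold ibepStep
  split_ifs <;> linarith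

lemma ibepStep_mono {b b' x : ℝ} (hbb : b ≤ b') (z : ℂ) :
    p.ibepStep b x z ≤ p.ibepStep b' x z := by
  unfold ibepStep
  split_ifs <;> linarith

/-- The energy harvested in one interval minus the demand, which is `M` after a negative
acknowledgment. -/
noncomputable def netInput (x : ℝ) (z : ℂ) : ℝ :=
  x - {z | p.Nack z}.indicator (fun _ => p.M) z

variable {p} in
lemma netInput_of_nack {x : ℝ} {z : ℂ} (hz : p.Nack z) : p.netInput x z = x - p.M := by
  rw [netInput, Set.indicator_of_mem (by exact hz)]

variable {p} in
lemma netInput_of_not_nack {x : ℝ} {z : ℂ} (hz : ¬ p.Nack z) : p.netInput x z = x := by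
  rw [netInput, Set.indicator_of_notMem (by exact hz), sub_zero]

variable {p} in
lemma ibepStep_of_shortage {b x : ℝ} {z : ℂ} (hz : p.Nack z) (hb : b < p.M) :
    p.ibepStep b x z = x := by
  simp [ibepStep, hz, hb.not_ge]

variable {p} in
lemma ibepStep_of_no_shortage {b x : ℝ} {z : ℂ} (h : ¬ (p.Nack z ∧ b < p.M)) :
    p.ibepStep b x z = b + p.netInput x z := by
  by_cases hz : p.Nack z
  · have hb : p.M ≤ b := not_lt.1 fun hb => h ⟨hz, hb⟩
    rw [netInput_of_nack hz, ibepStep, if_neg (not_not.2 hz), if_pos hb]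
    ring
  · rw [netInput_of_not_nack hz, ibepStep, if_pos hz]

lemma add_netInput_le_ibepStep (b x : ℝ) (z : ℂ) : b + p.netInput x z ≤ p.ibepStep b x z := by
  by_cases h : p.Nack z ∧ b < p.M
  · rw [ibepStep_of_shortage h.1 h.2, netInput_of_nack h.1]
    linarith [h.2]
  · rw [ibepStep_of_no_shortage h]

lemma measurable_netInput : Measurable fun q : ℝ × ℂ => p.netInput q.1 q.2 :=
  measurable_fst.sub ((measurable_const.indicator p.measurableSet_nack).comp measurable_snd)

lemma measurable_ibepStep : Measurable fun q : ℝ × ℝ × ℂ => p.ibepStep q.1 q.2.1 q.2.2 := by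
  unfold ibepStep
  have hz : MeasurableSet {q : ℝ × ℝ × ℂ | p.Nack q.2.2} :=
    (measurable_snd.comp measurable_snd) p.measurableSet_nack
  exact Measurable.ite hz.compl (by fun_prop)
    (Measurable.ite (measurableSet_le measurable_const measurable_fst) (by fun_prop) (by fun_prop))

variable {p} in
lemma drift_nonneg (hphi : p.phiInc ≤ 1) :
    0 ≤ 1 / p.lam1 - p.M * p.nackProb := by
  rw [sub_nonneg, le_div_iff₀ p.lam1_pos]
  rw [phiInc_eq] at hphi
  linarith

lemma smallInputProb_pos :
    0 < p.nackProb * (1 - Real.exp (-(p.lam1 * (p.M / 2)))) := by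
  have hM := p.M_pos
  have hl := p.lam1_pos
  refine mul_pos p.nackProb_pos (sub_pos.2 (Real.exp_lt_one_iff.2 ?_))
  have : 0 < p.lam1 * (p.M / 2) := by positivity
  linarith

lemma measurableSet_smallInput :
    MeasurableSet {q : ℝ × ℂ | p.Nack q.2 ∧ q.1 ≤ p.M / 2} :=
  (measurable_snd p.measurableSet_nack).inter (measurableSet_le measurable_fst measurable_const)

section Buffer

variable {Ω : Type*} {B0 : Ω → ℝ} {X : ℕ → Ω → ℝ} {h : ℕ → Ω → ℂ} {ω : Ω}

lemma buffer_succ (i : ℕ) :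
    p.buffer B0 X h (i + 1) ω = p.ibepStep (p.buffer B0 X h i ω) (X i ω) (h i ω) := rfl

lemma buffer_nonneg (hX : ∀ i, 0 ≤ X i ω) (hB : 0 ≤ B0 ω) (i : ℕ) :
    0 ≤ p.buffer B0 X h i ω := by
  induction i with
  | zero => exact hB
  | succ i ih => exact p.ibepStep_nonneg ih (hX i) _

lemma buffer_zero_le (hB : 0 ≤ B0 ω) (i : ℕ) :
    p.buffer 0 X h i ω ≤ p.buffer B0 X h i ω := by
  induction i with
  | zero => exact hB
  | succ i ih => exact p.ibepStep_mono ih _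

/-- A buffer started empty one interval later stays below the one started empty at time `0`. -/
lemma buffer_shift_le (hX : ∀ i, 0 ≤ X i ω) (i : ℕ) :
    p.buffer 0 (fun j => X (j + 1)) (fun j => h (j + 1)) i ω ≤ p.buffer 0 X h (i + 1) ω := by
  induction i with
  | zero => exact p.buffer_nonneg hX le_rfl 1
  | succ i ih => exact p.ibepStep_mono ih _

lemma buffer_measurable {m : MeasurableSpace Ω} {i : ℕ}
    (hZ : ∀ j < i, Measurable[m] fun ω => (X j ω, h j ω)) :
    Measurable[m] (p.buffer 0 X h i) := by
  induction i with
  | zero => exact measurable_const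
  | succ i ih =>
    have h1 : Measurable[m] (p.buffer 0 X h i) := ih fun j hj => hZ j (by omega)
    have h2 : Measurable[m] fun ω => (p.buffer 0 X h i ω, X i ω, h i ω) :=
      h1.prodMk (hZ i (Nat.lt_succ_self i))
    have h3 := p.measurable_ibepStep.comp h2
    exact h3

lemma measurable_buffer_past (i : ℕ) :
    Measurable[past (fun i ω => (X i ω, h i ω)) i] (p.buffer 0 X h i) :=
  p.buffer_measurable fun _ hj => measurable_past (Z := fun i ω => (X i ω, h i ω)) hj

/-- The buffer started empty is a function of the sequence of inputs. -/
lemma buffer_eq_comp (i : ℕ) :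
    p.buffer 0 X h i ω = p.buffer (Ω := ℕ → ℝ × ℂ) 0 (fun j u => (u j).1) (fun j u => (u j).2) i
      (fun j => (X j ω, h j ω)) := by
  induction i with
  | zero => rfl
  | succ i ih => rw [buffer_succ, buffer_succ, ih]

/-! ### The unreflected walk and the energy shortage -/

/-- The partial sums of the net inputs: the level of a buffer started empty that is allowed to
become negative. -/
noncomputable def walk (X : ℕ → Ω → ℝ) (h : ℕ → Ω → ℂ) (n : ℕ) (ω : Ω) : ℝ :=
  ∑ i ∈ Finset.range n, p.netInput (X i ω) (h i ω)

lemma walk_succ (n : ℕ) :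
    p.walk X h (n + 1) ω = p.walk X h n ω + p.netInput (X n ω) (h n ω) :=
  Finset.sum_range_succ _ _

/-- The accumulated shortage `∑ (M - B i)` over the intervals with a negative acknowledgment and
`B i < M`, in the buffer started empty. -/
noncomputable def shortage (X : ℕ → Ω → ℝ) (h : ℕ → Ω → ℂ) (n : ℕ) (ω : Ω) : ℝ :=
  p.buffer 0 X h n ω - p.walk X h n ω

lemma shortage_zero : p.shortage X h 0 ω = 0 := by simp [shortage, buffer, walk]

lemma shortage_le_succ (n : ℕ) : p.shortage X h n ω ≤ p.shortage X h (n + 1) ω := by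
  have := p.add_netInput_le_ibepStep (p.buffer 0 X h n ω) (X n ω) (h n ω)
  rw [shortage, shortage, walk_succ, buffer_succ]
  linarith

lemma shortage_nonneg (n : ℕ) : 0 ≤ p.shortage X h n ω := by
  induction n with
  | zero => rw [shortage_zero]
  | succ n ih => exact ih.trans (p.shortage_le_succ n)

lemma walk_le_buffer (n : ℕ) : p.walk X h n ω ≤ p.buffer 0 X h n ω :=
  sub_nonneg.1 (p.shortage_nonneg n)

/-- The shortage grows only while the level `walk + shortage` is below `M`, so that a lower bound
on the walk is an upper bound on the shortage. -/
lemma shortage_le {C ε : ℝ} (hε : 0 ≤ ε) (hC : 0 ≤ C)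
    (hw : ∀ n : ℕ, -C - ε * n ≤ p.walk X h n ω) (n : ℕ) :
    p.shortage X h n ω ≤ C + p.M + ε * n := by
  induction n with
  | zero => rw [shortage_zero]; have := p.M_pos; simp; linarith
  | succ n ih =>
    by_cases hs : p.Nack (h n ω) ∧ p.buffer 0 X h n ω < p.M
    · rw [shortage, walk_succ, buffer_succ, ibepStep_of_shortage hs.1 hs.2,
        netInput_of_nack hs.1]
      have := hw n
      push_cast
      linarith
    · rw [shortage, walk_succ, buffer_succ, ibepStep_of_no_shortage hs]
      rw [shortage] at ih
      push_cast
      linarith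

lemma tendsto_shortage_div {m : ℝ} (hm : 0 ≤ m)
    (hw : Tendsto (fun n : ℕ => p.walk X h n ω / n) atTop (𝓝 m)) :
    Tendsto (fun n : ℕ => p.shortage X h n ω / n) atTop (𝓝 0) := by
  rw [Metric.tendsto_atTop']
  intro ε hε
  obtain ⟨N, hN⟩ := eventually_atTop.1
    (hw.eventually (lt_mem_nhds (show -(ε / 2) < m by linarith)))
  set C : ℝ := ∑ i ∈ Finset.range (N + 1), |p.walk X h i ω| with hCdef
  have hC : 0 ≤ C := Finset.sum_nonneg fun _ _ => abs_nonneg _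
  have hlow : ∀ n : ℕ, -C - ε / 2 * n ≤ p.walk X h n ω := by
    intro n
    have hn0 : 0 ≤ ε / 2 * (n : ℝ) := by positivity
    rcases le_or_gt n N with hn | hn
    · have h1 : |p.walk X h n ω| ≤ C :=
        Finset.single_le_sum (f := fun i => |p.walk X h i ω|) (fun _ _ => abs_nonneg _)
          (Finset.mem_range.2 (by omega))
      have := neg_abs_le (p.walk X h n ω)
      linarith
    · have h1 := hN n hn.le
      have hn1 : 0 < (n : ℝ) := by exact_mod_cast (Nat.zero_le N).trans_lt hn
      rw [lt_div_iff₀ hn1] at h1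
      linarith
  obtain ⟨N', hN'⟩ := exists_nat_gt ((C + p.M) / (ε / 2))
  refine ⟨N', fun n hn => ?_⟩
  have hn0 : 0 < (n : ℝ) := by exact_mod_cast (Nat.zero_le N').trans_lt hn
  have h1 := p.shortage_le (by linarith) hC hlow n
  have h2 : C + p.M < n * (ε / 2) :=
    (div_lt_iff₀ (by linarith)).1 (hN'.trans (by exact_mod_cast hn))
  rw [Real.dist_eq, sub_zero, abs_of_nonneg (div_nonneg (p.shortage_nonneg n) hn0.le),
    div_lt_iff₀ hn0]
  linarith

/-- Each negative acknowledgment at a level of at most `M / 2` adds at least `M / 2` to the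
shortage. -/
lemma visits_nack_le_shortage (n : ℕ) :
    p.M / 2 * visits (fun i => {ω | p.buffer 0 X h i ω ≤ p.M / 2} ∩ {ω | p.Nack (h i ω)}) n ω
      ≤ p.shortage X h n ω := by
  induction n with
  | zero => simp [visits_zero, shortage_zero]
  | succ n ih =>
    rw [visits_succ, mul_add]
    by_cases hs : ω ∈ {ω | p.buffer 0 X h n ω ≤ p.M / 2} ∩ {ω | p.Nack (h n ω)}
    · have hM := p.M_pos
      have hb : p.buffer 0 X h n ω ≤ p.M / 2 := hs.1
      have hz : p.Nack (h n ω) := hs.2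
      rw [Set.indicator_of_mem hs, shortage, walk_succ, buffer_succ,
        ibepStep_of_shortage hz (by linarith), netInput_of_nack hz]
      rw [shortage] at ih
      linarith
    · rw [Set.indicator_of_notMem hs, mul_zero, add_zero]
      exact ih.trans (p.shortage_le_succ n)

lemma ibepStep_le_of_nack {K b x : ℝ} {z : ℂ} (hK : p.M / 2 ≤ K) (hz : p.Nack z)
    (hx : x ≤ p.M / 2) (hb : b ≤ K + p.M / 2) : p.ibepStep b x z ≤ K := by
  unfold ibepStep
  split_ifs <;> first | contradiction | linarith

/-- A negative acknowledgment with an input of at most `M / 2` leads from below `M` to at most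
`M / 2`; the summand `1` accounts for the shift of time by one interval. -/
lemma visits_small_input_le (n : ℕ) :
    visits (fun i => {ω | p.buffer 0 X h i ω < p.M} ∩
      {ω | p.Nack (h i ω) ∧ X i ω ≤ p.M / 2}) n ω
      ≤ visits (fun i => {ω | p.buffer 0 X h i ω ≤ p.M / 2}) n ω + 1 := by
  have key : ∀ n, visits (fun i => {ω | p.buffer 0 X h i ω < p.M} ∩
      {ω | p.Nack (h i ω) ∧ X i ω ≤ p.M / 2}) n ω
      ≤ visits (fun i => {ω | p.buffer 0 X h (i + 1) ω ≤ p.M / 2}) n ω := by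
    intro n
    refine Finset.sum_le_sum fun i _ => Set.indicator_le_indicator_of_subset ?_
      (fun _ => zero_le_one) ω
    rintro ω' ⟨hb, hz, hx⟩
    have hb' : p.buffer 0 X h i ω' < p.M := hb
    exact p.ibepStep_le_of_nack le_rfl hz hx (by linarith)
  refine (key n).trans ?_
  have h1 := Finset.sum_range_succ' (fun i =>
    ({ω | p.buffer 0 X h i ω ≤ p.M / 2}).indicator (fun _ => (1 : ℝ)) ω) n
  have h2 := visits_succ (fun i => {ω | p.buffer 0 X h i ω ≤ p.M / 2}) n ω
  have h3 : ({ω | p.buffer 0 X h n ω ≤ p.M / 2}).indicator (fun _ => (1 : ℝ)) ω ≤ 1 :=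
    Set.indicator_le_self' (fun _ _ => zero_le_one) _
  have h4 : 0 ≤ ({ω | p.buffer 0 X h 0 ω ≤ p.M / 2}).indicator (fun _ => (1 : ℝ)) ω :=
    Set.indicator_nonneg (fun _ _ => zero_le_one) _
  simp only [visits] at h2 ⊢
  linarith

end Buffer

end LinkParams

/-! ### Almost sure behaviour of the buffer started empty -/

namespace LinkModel

open LinkParams

variable {Ω : Type*} [MeasurableSpace Ω] {μ : Measure Ω}
  {p : LinkParams} {B0 : Ω → ℝ} {X : ℕ → Ω → ℝ} {h : ℕ → Ω → ℂ}

lemma measurable_input (hm : LinkModel μ p B0 X h) (i : ℕ) : Measurable fun ω => (X i ω, h i ω) :=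
  (hm.measurable_X i).prodMk (hm.measurable_h i)

lemma map_input [IsProbabilityMeasure μ] (hm : LinkModel μ p B0 X h) (i : ℕ) :
    μ.map (fun ω => (X i ω, h i ω))
    = (expMeasure p.lam1).prod (complexGaussian p.channelVar) := by
  rw [(indepFun_iff_map_prod_eq_prod_map_map (hm.measurable_X i).aemeasurable
    (hm.measurable_h i).aemeasurable).1 (hm.indep_X_h i), hm.law_X, hm.law_h]

lemma ae_X_nonneg (hm : LinkModel μ p B0 X h) : ∀ᵐ ω ∂μ, ∀ i, 0 ≤ X i ω := by
  refine ae_all_iff.2 fun i => ae_of_ae_map (hm.measurable_X i).aemeasurable ?_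
  rw [hm.law_X]
  exact ae_nonneg_expMeasure _

lemma measureReal_nack (hm : LinkModel μ p B0 X h) (i : ℕ) :
    μ.real {ω | p.Nack (h i ω)} = p.nackProb := by
  rw [← p.complexGaussian_real_nack, ← hm.law_h i,
    map_measureReal_apply (hm.measurable_h i) p.measurableSet_nack]
  rfl

lemma measureReal_small_input (hm : LinkModel μ p B0 X h) (i : ℕ) :
    μ.real {ω | p.Nack (h i ω) ∧ X i ω ≤ p.M / 2}
    = p.nackProb * (1 - Real.exp (-(p.lam1 * (p.M / 2)))) := by
  have hM := p.M_pos
  have h1 := (hm.indep_X_h i).measure_inter_preimage_eq_mul _ _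
    (measurableSet_Iic (a := p.M / 2)) p.measurableSet_nack
  have h2 : μ.real (X i ⁻¹' Set.Iic (p.M / 2)) = 1 - Real.exp (-(p.lam1 * (p.M / 2))) := by
    rw [← map_measureReal_apply (hm.measurable_X i) measurableSet_Iic, hm.law_X,
      expMeasure_real_Iic p.lam1_pos (by positivity)]
  have h3 : {ω | p.Nack (h i ω) ∧ X i ω ≤ p.M / 2}
      = X i ⁻¹' Set.Iic (p.M / 2) ∩ h i ⁻¹' {z | p.Nack z} := by
    ext ω; exact and_comm
  rw [h3, measureReal_def, h1, ENNReal.toReal_mul, ← measureReal_def, ← measureReal_def, h2,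
    mul_comm]
  congr 1
  exact hm.measureReal_nack i

lemma measurable_buffer_zero (hm : LinkModel μ p B0 X h) (i : ℕ) : Measurable (p.buffer 0 X h i) :=
  p.buffer_measurable fun j _ => hm.measurable_input j

/-- The strong law of large numbers for the unreflected walk. -/
lemma ae_tendsto_walk_div [IsProbabilityMeasure μ] (hm : LinkModel μ p B0 X h) :
    ∀ᵐ ω ∂μ, Tendsto (fun n : ℕ => p.walk X h n ω / n) atTop
    (𝓝 (1 / p.lam1 - p.M * p.nackProb)) := by
  have hmeas := p.measurable_netInput
  have hXi : Integrable (X 0) μ := by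
    have h1 := integrable_id_expMeasure p.lam1_pos
    rw [← hm.law_X 0] at h1
    exact h1.comp_measurable (hm.measurable_X 0)
  have hXm : ∫ ω, X 0 ω ∂μ = 1 / p.lam1 := by
    have h1 := integral_map (μ := μ) (f := fun x : ℝ => x) (hm.measurable_X 0).aemeasurable
      measurable_id.aestronglyMeasurable
    rw [← h1, hm.law_X, integral_id_expMeasure p.lam1_pos]
  have hA : MeasurableSet {ω | p.Nack (h 0 ω)} := hm.measurable_h 0 p.measurableSet_nack
  have hfun : (fun ω => p.netInput (X 0 ω) (h 0 ω))
      = fun ω => X 0 ω - {ω | p.Nack (h 0 ω)}.indicator (fun _ => p.M) ω := rfl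
  have hind : Integrable ({ω | p.Nack (h 0 ω)}.indicator (fun _ => p.M)) μ :=
    (integrable_const p.M).indicator hA
  have hmean : ∫ ω, p.netInput (X 0 ω) (h 0 ω) ∂μ = 1 / p.lam1 - p.M * p.nackProb := by
    rw [hfun, integral_sub hXi hind, hXm, integral_indicator_const _ hA, hm.measureReal_nack,
      smul_eq_mul, mul_comm]
  rw [← hmean]
  refine strong_law_ae_real (fun i ω => p.netInput (X i ω) (h i ω)) ?_ ?_ ?_
  · rw [hfun]; exact hXi.sub hind
  · intro i j hij
    exact (hm.indep_intervals.indepFun hij).comp hmeas hmeas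
  · intro i
    have hid : IdentDistrib (fun ω => (X i ω, h i ω)) (fun ω => (X 0 ω, h 0 ω)) μ μ :=
      ⟨(hm.measurable_input i).aemeasurable, (hm.measurable_input 0).aemeasurable, by
        rw [hm.map_input, hm.map_input]⟩
    exact hid.comp hmeas

/-- The thinning by negative acknowledgments has frequency zero because it is dominated by the
shortage. -/
lemma ae_tendsto_visits_le_half [IsProbabilityMeasure μ] (hm : LinkModel μ p B0 X h) (hphi :
    p.phiInc ≤ 1) : ∀ᵐ ω ∂μ,
    Tendsto (fun n : ℕ => visits (fun i => {ω | p.buffer 0 X h i ω ≤ p.M / 2}) n ω / n)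
      atTop (𝓝 0) := by
  have hM := p.M_pos
  refine tendsto_frequency_zero_of_thinned (Z := fun i ω => (X i ω, h i ω))
    (A := Prod.snd ⁻¹' {z | p.Nack z}) hm.measurable_input hm.indep_intervals
    (measurable_snd p.measurableSet_nack)
    (fun i => p.measurable_buffer_past i measurableSet_Iic) p.nackProb_pos
    hm.measureReal_nack ?_
  filter_upwards [hm.ae_tendsto_walk_div] with ω hω
  have hs := (p.tendsto_shortage_div (drift_nonneg hphi) hω).const_mul (2 / p.M)
  rw [mul_zero] at hs
  refine squeeze_zero (fun n => div_nonneg (visits_nonneg _ _ _) n.cast_nonneg) (fun n => ?_) hs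
  have h1 := p.visits_nack_le_shortage (X := X) (h := h) (ω := ω) n
  rw [← mul_div_assoc]
  refine div_le_div_of_nonneg_right ?_ n.cast_nonneg
  rw [div_mul_eq_mul_div, le_div_iff₀ hM]
  have h2 : visits (fun i => {ω | p.buffer 0 X h i ω ≤ p.M / 2} ∩
    (fun ω => (X i ω, h i ω)) ⁻¹' (Prod.snd ⁻¹' {z | p.Nack z})) n ω
    = visits (fun i => {ω | p.buffer 0 X h i ω ≤ p.M / 2} ∩ {ω | p.Nack (h i ω)}) n ω := rfl
  rw [h2]
  linarith

/-- The thinning by negative acknowledgments with an input of at most `M / 2` has frequency zero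
because each such time is followed by a level of at most `M / 2`. -/
lemma ae_tendsto_visits_lt [IsProbabilityMeasure μ] (hm : LinkModel μ p B0 X h) (hphi :
    p.phiInc ≤ 1) : ∀ᵐ ω ∂μ,
    Tendsto (fun n : ℕ => visits (fun i => {ω | p.buffer 0 X h i ω < p.M}) n ω / n)
      atTop (𝓝 0) := by
  refine tendsto_frequency_zero_of_thinned (Z := fun i ω => (X i ω, h i ω))
    (A := {q | p.Nack q.2 ∧ q.1 ≤ p.M / 2}) hm.measurable_input hm.indep_intervals
    p.measurableSet_smallInput
    (fun i => p.measurable_buffer_past i measurableSet_Iio) p.smallInputProb_pos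
    hm.measureReal_small_input ?_
  filter_upwards [hm.ae_tendsto_visits_le_half hphi] with ω hω
  have hs := hω.add (tendsto_one_div_atTop_nhds_zero_nat (𝕜 := ℝ))
  rw [add_zero] at hs
  refine squeeze_zero (fun n => div_nonneg (visits_nonneg _ _ _) n.cast_nonneg) (fun n => ?_) hs
  rw [← add_div]
  exact div_le_div_of_nonneg_right (p.visits_small_input_le n) n.cast_nonneg

/-! ### Convergence to infinity in probability -/

/-- The law of the buffer started empty increases stochastically with time, because the inputs
from interval `1` on have the same joint law as those from interval `0` on. -/
lemma antitone_measureReal_buffer_zero_le [IsProbabilityMeasure μ] (hm : LinkModel μ p B0 X h) (K :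
    ℝ) :
    Antitone fun i => μ.real {ω | p.buffer 0 X h i ω ≤ K} := by
  refine antitone_nat_of_succ_le fun i => ?_
  set Z : ℕ → Ω → ℝ × ℂ := fun i ω => (X i ω, h i ω) with hZ
  have hZm : ∀ i, Measurable (Z i) := hm.measurable_input
  have hlaw : μ.map (fun ω j => Z (j + 1) ω) = μ.map (fun ω j => Z j ω) := by
    have hind : iIndepFun (fun j => Z (j + 1)) μ :=
      hm.indep_intervals.precomp (g := fun j => j + 1) (add_left_injective 1)
    rw [hind.map_fun_eq_infinitePi_map fun j => hZm (j + 1),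
      hm.indep_intervals.map_fun_eq_infinitePi_map hZm]
    congr 1
    funext j
    rw [hm.map_input, hm.map_input]
  set F : (ℕ → ℝ × ℂ) → ℝ :=
    p.buffer (Ω := ℕ → ℝ × ℂ) 0 (fun j u => (u j).1) (fun j u => (u j).2) i with hF
  have hFm : Measurable F := p.buffer_measurable fun j _ =>
    (measurable_pi_apply (X := fun _ : ℕ => ℝ × ℂ) j)
  have hS : MeasurableSet {u | F u ≤ K} := hFm measurableSet_Iic
  have h0 : μ.real {ω | p.buffer 0 X h i ω ≤ K}
      = (μ.map (fun ω j => Z j ω)).real {u | F u ≤ K} := by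
    rw [map_measureReal_apply (measurable_pi_lambda _ hZm) hS]
    congr 1
    ext ω
    change _ ≤ K ↔ F _ ≤ K
    rw [p.buffer_eq_comp]
  have h1 : μ.real {ω | p.buffer 0 (fun j => X (j + 1)) (fun j => h (j + 1)) i ω ≤ K}
      = (μ.map (fun ω j => Z (j + 1) ω)).real {u | F u ≤ K} := by
    rw [map_measureReal_apply (measurable_pi_lambda _ fun j => hZm (j + 1)) hS]
    congr 1
    ext ω
    change _ ≤ K ↔ F _ ≤ K
    rw [p.buffer_eq_comp]
  change μ.real {ω | p.buffer 0 X h (i + 1) ω ≤ K} ≤ μ.real {ω | p.buffer 0 X h i ω ≤ K}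
  rw [h0, ← hlaw, ← h1]
  refine ENNReal.toReal_mono (measure_ne_top _ _) (measure_mono_ae ?_)
  filter_upwards [hm.ae_X_nonneg] with ω hω hle
  exact (p.buffer_shift_le hω i).trans hle

/-- By dominated convergence the average of `Pr {B i ≤ M / 2}` tends to zero, and by monotonicity
so do the terms. -/
lemma tendsto_measureReal_buffer_zero_le_half [IsProbabilityMeasure μ] (hm : LinkModel μ p B0 X h)
    (hphi : p.phiInc ≤ 1) :
    Tendsto (fun i => μ.real {ω | p.buffer 0 X h i ω ≤ p.M / 2}) atTop (𝓝 0) := by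
  set s : ℕ → Set Ω := fun i => {ω | p.buffer 0 X h i ω ≤ p.M / 2} with hs
  have hsm : ∀ i, MeasurableSet (s i) := fun i => hm.measurable_buffer_zero i measurableSet_Iic
  have hint : ∀ n : ℕ, ∫ ω, visits s n ω / n ∂μ = (∑ i ∈ Finset.range n, μ.real (s i)) / n := by
    intro n
    rw [integral_div]
    congr 1
    simp only [visits]
    rw [integral_finsetSum _ fun i _ => (integrable_const (1 : ℝ)).indicator (hsm i)]
    refine Finset.sum_congr rfl fun i _ => ?_
    rw [integral_indicator_const _ (hsm i), smul_eq_mul, mul_one]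
  have hlim : Tendsto (fun n : ℕ => ∫ ω, visits s n ω / n ∂μ) atTop (𝓝 (∫ _, (0 : ℝ) ∂μ)) := by
    refine tendsto_integral_of_dominated_convergence (fun _ => (1 : ℝ)) (fun n =>
      ((visits_measurable fun i _ => hsm i).div_const _).aestronglyMeasurable)
      (integrable_const 1) (fun n => ae_of_all _ fun ω => ?_) (hm.ae_tendsto_visits_le_half hphi)
    rw [Real.norm_eq_abs, abs_of_nonneg (div_nonneg (visits_nonneg _ _ _) n.cast_nonneg)]
    exact div_le_one_of_le₀ (visits_le _ _ _) n.cast_nonneg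
  simp_rw [hint, integral_zero] at hlim
  refine squeeze_zero' (Eventually.of_forall fun _ => measureReal_nonneg) ?_ hlim
  filter_upwards [eventually_gt_atTop 0] with n hn
  have hn0 : (0 : ℝ) < n := by exact_mod_cast hn
  rw [le_div_iff₀ hn0]
  calc μ.real (s n) * n = ∑ i ∈ Finset.range n, μ.real (s n) := by simp [mul_comm]
    _ ≤ ∑ i ∈ Finset.range n, μ.real (s i) := Finset.sum_le_sum fun i hi =>
        hm.antitone_measureReal_buffer_zero_le _ (Finset.mem_range.1 hi).le

/-- From a level of at most `K + M / 2` the buffer falls to at most `K` in one interval with a fixed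
positive probability, so that the bound at level `M / 2` propagates to all levels. -/
lemma tendsto_measureReal_buffer_zero_le [IsProbabilityMeasure μ] (hm : LinkModel μ p B0 X h)
    (hphi : p.phiInc ≤ 1) (K : ℝ) :
    Tendsto (fun i => μ.real {ω | p.buffer 0 X h i ω ≤ K}) atTop (𝓝 0) := by
  have hM := p.M_pos
  have key : ∀ k : ℕ, Tendsto (fun i => μ.real {ω | p.buffer 0 X h i ω ≤ p.M / 2 + k * (p.M / 2)})
      atTop (𝓝 0) := by
    intro k
    induction k with
    | zero => simpa using hm.tendsto_measureReal_buffer_zero_le_half hphi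
    | succ k ih =>
      have hδ := p.smallInputProb_pos
      set δ := p.nackProb * (1 - Real.exp (-(p.lam1 * (p.M / 2))))
      have h1 := ((tendsto_add_atTop_iff_nat 1).2 ih).const_mul δ⁻¹
      rw [mul_zero] at h1
      refine squeeze_zero (fun _ => measureReal_nonneg) (fun i => ?_) h1
      have h2 := measure_inter_of_past (μ := μ) (Z := fun i ω => (X i ω, h i ω))
        (E := {ω | p.buffer 0 X h i ω ≤ p.M / 2 + (k + 1 : ℕ) * (p.M / 2)})
        hm.measurable_input hm.indep_intervals
        (p.measurable_buffer_past i measurableSet_Iic) p.measurableSet_smallInput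
      have h3 : μ.real ((fun ω => (X i ω, h i ω)) ⁻¹' {q : ℝ × ℂ | p.Nack q.2 ∧ q.1 ≤ p.M / 2})
          = δ := hm.measureReal_small_input i
      rw [h3] at h2
      rw [inv_mul_eq_div, le_div_iff₀ hδ, ← h2]
      refine measureReal_mono ?_
      rintro ω ⟨hb, hz, hx⟩
      have hb' : p.buffer 0 X h i ω ≤ p.M / 2 + (k + 1 : ℕ) * (p.M / 2) := hb
      push_cast at hb'
      refine p.ibepStep_le_of_nack ?_ hz hx (by linarith)
      have : 0 ≤ (k : ℝ) * (p.M / 2) := by positivity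
      linarith
  obtain ⟨k, hk⟩ := exists_nat_gt (K / (p.M / 2))
  rw [div_lt_iff₀ (by positivity)] at hk
  refine squeeze_zero (fun _ => measureReal_nonneg) (fun i => measureReal_mono fun ω hω => ?_)
    (key k)
  have hω' : p.buffer 0 X h i ω ≤ K := hω
  change p.buffer 0 X h i ω ≤ _
  linarith

lemma ae_buffer_zero_le (hm : LinkModel μ p B0 X h) :
    ∀ᵐ ω ∂μ, ∀ i, p.buffer 0 X h i ω ≤ p.buffer B0 X h i ω := by
  filter_upwards [hm.B0_nonneg] with ω hω i
  exact p.buffer_zero_le hω i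

lemma tendsto_measureReal_buffer_le [IsProbabilityMeasure μ] (hm : LinkModel μ p B0 X h) (hphi :
    p.phiInc ≤ 1) (K : ℝ) :
    Tendsto (fun i => μ.real {ω | p.buffer B0 X h i ω ≤ K}) atTop (𝓝 0) := by
  refine squeeze_zero (fun _ => measureReal_nonneg) (fun i => ?_)
    (hm.tendsto_measureReal_buffer_zero_le hphi K)
  refine ENNReal.toReal_mono (measure_ne_top _ _) (measure_mono_ae ?_)
  filter_upwards [hm.ae_buffer_zero_le] with ω hω hle
  exact (hω i).trans hle

lemma measurable_buffer (hm : LinkModel μ p B0 X h) (i : ℕ) : Measurable (p.buffer B0 X h i) := by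
  induction i with
  | zero => exact hm.measurable_B0
  | succ i ih =>
    have h2 : Measurable fun ω => (p.buffer B0 X h i ω, X i ω, h i ω) :=
      ih.prodMk (hm.measurable_input i)
    have h3 := p.measurable_ibepStep.comp h2
    exact h3

lemma tendsto_measureReal_buffer_lt [IsProbabilityMeasure μ] (hm : LinkModel μ p B0 X h) (hphi :
    p.phiInc ≤ 1) :
    Tendsto (fun i => μ.real {ω | p.M ≤ p.buffer B0 X h i ω}ᶜ) atTop (𝓝 0) :=
  squeeze_zero (fun _ => measureReal_nonneg)
    (fun i => measureReal_mono fun ω (hω : ¬ p.M ≤ p.buffer B0 X h i ω) => (not_le.1 hω).le)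
    (hm.tendsto_measureReal_buffer_le hphi p.M)

lemma ae_eventually_le_buffer [IsProbabilityMeasure μ] (hm : LinkModel μ p B0 X h) (hphi :
    p.phiInc < 1) :
    ∀ᵐ ω ∂μ, ∀ᶠ i in atTop, p.M ≤ p.buffer B0 X h i ω := by
  have hd : 0 < 1 / p.lam1 - p.M * p.nackProb := by
    rw [sub_pos, lt_div_iff₀ p.lam1_pos]
    rw [phiInc_eq] at hphi
    linarith
  filter_upwards [hm.ae_tendsto_walk_div, hm.ae_buffer_zero_le] with ω hω hle
  have h1 := hω.pos_mul_atTop hd tendsto_natCast_atTop_atTop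
  filter_upwards [h1.eventually_ge_atTop p.M, eventually_gt_atTop 0] with n hn hn0
  rw [div_mul_cancel₀ _ (by positivity)] at hn
  exact hn.trans ((p.walk_le_buffer n).trans (hle n))

end LinkModel

/-! ### Time fractions and limiting distributions -/

lemma timeFraction_eq_one_sub_visits {Ω : Type*} (s : ℕ → Set Ω) (ω : Ω) {N : ℕ} (hN : 0 < N) :
    timeFraction (fun i => ω ∉ s i) N = 1 - visits s N ω / N := by
  classical
  have hN0 : (N : ℝ) ≠ 0 := by positivity
  have h1 : visits s N ω = ((Finset.range N).filter fun i => ω ∈ s i).card := by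
    rw [visits, Finset.card_filter]
    push_cast
    rfl
  have h2 := Finset.card_filter_add_card_filter_not (s := Finset.range N) (fun i => ω ∈ s i)
  rw [Finset.card_range] at h2
  have h3 : visits s N ω + ((Finset.range N).filter fun i => ω ∉ s i).card = N := by
    rw [h1]; exact_mod_cast h2
  rw [timeFraction, eq_sub_iff_add_eq, ← add_div, div_eq_one_iff_eq hN0, ← h3, add_comm]
  congr!

/-- A real process that leaves every half-line `(-∞, x]` in probability has no limiting
distribution. -/
lemma not_hasLimitingDistribution_of_tendsto_zero {Ω : Type*} [MeasurableSpace Ω] {μ : Measure Ω}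
    {B : ℕ → Ω → ℝ} (hB : ∀ x, Tendsto (fun i => μ.real {ω | B i ω ≤ x}) atTop (𝓝 0)) :
    ¬ HasLimitingDistribution μ B := by
  rintro ⟨π, hπ, hlim⟩
  have hF : (fun y : ℝ => π.real (Set.Iic y)) = cdf π := funext fun y => (cdf_eq_real π y).symm
  have hcount : {x | ¬ ContinuousAt (fun y : ℝ => π.real (Set.Iic y)) x}.Countable := by
    rw [hF]
    exact (monotone_cdf π).countable_not_continuousAt
  obtain ⟨a, ha⟩ :=
    ((tendsto_cdf_atTop π).eventually (lt_mem_nhds zero_lt_one)).exists_forall_of_atTop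
  obtain ⟨x, hx, hxa⟩ := (hcount.dense_compl ℝ).exists_gt a
  have hc : ContinuousAt (fun y : ℝ => π.real (Set.Iic y)) x := by simpa using hx
  have h0 := tendsto_nhds_unique (hlim x hc) (hB x)
  have h1 := ha x hxa.le
  rw [cdf_eq_real, h0] at h1
  exact lt_irrefl _ h1

lemma LinkParams.relayPower_eq_iff (p : LinkParams) (b : ℝ) :
    p.relayPower b = 2 * p.M ↔ p.M ≤ b := by
  rw [relayPower, div_eq_iff (by norm_num), show 2 * p.M * (1 / 2) = p.M by ring]
  exact min_eq_right_iff

theorem theorem2 {Ω : Type*} [MeasurableSpace Ω] (μ : Measure Ω) [IsProbabilityMeasure μ]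
    (p : LinkParams) (B0 : Ω → ℝ) (X : ℕ → Ω → ℝ) (h : ℕ → Ω → ℂ)
    (hmodel : LinkModel μ p B0 X h) (hphi : p.phiInc ≤ 1) :
    -- the buffer has no limiting energy distribution
    ¬ HasLimitingDistribution μ (p.buffer B0 X h) ∧
    -- asymptotically, energy `M` is available with probability one
    Tendsto (fun i => μ.real {ω | p.M ≤ p.buffer B0 X h i ω}) atTop (𝓝 1) ∧
    -- asymptotically, the relay power is `2 M` with probability one, also given a NACK
    Tendsto (fun i => μ.real {ω | p.relayPower (p.buffer B0 X h i ω) = 2 * p.M})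
      atTop (𝓝 1) ∧
    Tendsto (fun i => (μ[|{ω | p.Nack (h i ω)}]).real
        {ω | p.relayPower (p.buffer B0 X h i ω) = 2 * p.M}) atTop (𝓝 1) ∧
    -- almost surely, this is so in all intervals but an asymptotically negligible fraction
    (∀ᵐ ω ∂μ, Tendsto (timeFraction fun i =>
        p.M ≤ p.buffer B0 X h i ω ∧ p.relayPower (p.buffer B0 X h i ω) = 2 * p.M)
      atTop (𝓝 1)) ∧
    -- and, below the critical value, in all intervals from some interval on
    (p.phiInc < 1 → ∀ᵐ ω ∂μ, ∀ᶠ i in atTop,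
        p.M ≤ p.buffer B0 X h i ω ∧ p.relayPower (p.buffer B0 X h i ω) = 2 * p.M) := by
  simp only [LinkParams.relayPower_eq_iff, and_self]
  have hmeas : ∀ i, MeasurableSet {ω | p.M ≤ p.buffer B0 X h i ω} :=
    fun i => hmodel.measurable_buffer i measurableSet_Ici
  have hcompl := hmodel.tendsto_measureReal_buffer_lt hphi
  have hprob : Tendsto (fun i => μ.real {ω | p.M ≤ p.buffer B0 X h i ω}) atTop (𝓝 1) := by
    have h1 := hcompl.const_sub 1
    simp_rw [probReal_compl_eq_one_sub (hmeas _), sub_sub_cancel, sub_zero] at h1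
    exact h1
  refine ⟨not_hasLimitingDistribution_of_tendsto_zero
    (hmodel.tendsto_measureReal_buffer_le hphi), hprob, hprob, ?_, ?_,
    fun hlt => hmodel.ae_eventually_le_buffer hlt⟩
  · have hq : ∀ i, μ.real {ω | p.Nack (h i ω)} = p.nackProb := hmodel.measureReal_nack
    have hA : ∀ i, MeasurableSet {ω | p.Nack (h i ω)} :=
      fun i => hmodel.measurable_h i p.measurableSet_nack
    have hzero : Tendsto (fun i => (μ[|{ω | p.Nack (h i ω)}]).real
        {ω | p.M ≤ p.buffer B0 X h i ω}ᶜ) atTop (𝓝 0) := by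
      have h1 := hcompl.const_mul p.nackProb⁻¹
      rw [mul_zero] at h1
      refine squeeze_zero (fun _ => measureReal_nonneg) (fun i => ?_) h1
      rw [measureReal_def, cond_apply (hA i), ENNReal.toReal_mul, ENNReal.toReal_inv,
        ← measureReal_def, ← measureReal_def, hq]
      exact mul_le_mul_of_nonneg_left (measureReal_mono Set.inter_subset_right)
        (inv_nonneg.2 p.nackProb_pos.le)
    have hpm : ∀ i, IsProbabilityMeasure (μ[|{ω | p.Nack (h i ω)}]) := fun i =>
      cond_isProbabilityMeasure fun h0 => p.nackProb_pos.ne' (by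
        rw [← hq i, measureReal_def, h0, ENNReal.toReal_zero])
    have h1 := hzero.const_sub 1
    simp_rw [fun i => probReal_compl_eq_one_sub (μ := μ[|{ω | p.Nack (h i ω)}]) (hmeas i),
      sub_sub_cancel, sub_zero] at h1
    exact h1
  · filter_upwards [hmodel.ae_tendsto_visits_lt hphi, hmodel.ae_buffer_zero_le] with ω hω hle
    have hlow := hω.const_sub 1
    rw [sub_zero] at hlow
    have hfrac : ∀ {N : ℕ}, 0 < N → timeFraction (fun i => p.M ≤ p.buffer B0 X h i ω) N
        = 1 - visits (fun i => {ω | p.buffer B0 X h i ω < p.M}) N ω / N := by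
      intro N hN
      rw [← timeFraction_eq_one_sub_visits _ _ hN]
      exact congrArg (timeFraction · N) (funext fun i => propext not_lt.symm)
    refine tendsto_of_tendsto_of_tendsto_of_le_of_le' hlow tendsto_const_nhds ?_ ?_
    · filter_upwards [eventually_gt_atTop 0] with N hN
      rw [hfrac hN]
      refine sub_le_sub_left (div_le_div_of_nonneg_right (Finset.sum_le_sum fun i _ => ?_)
        N.cast_nonneg) _
      by_cases hi : p.buffer B0 X h i ω < p.M
      · have hi' : p.buffer 0 X h i ω < p.M := (hle i).trans_lt hi
        rw [Set.indicator_of_mem (by exact hi), Set.indicator_of_mem (by exact hi')]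
      · rw [Set.indicator_of_notMem (by exact hi)]
        exact Set.indicator_nonneg (fun _ _ => zero_le_one) _
    · filter_upwards [eventually_gt_atTop 0] with N hN
      rw [hfrac hN]
      exact sub_le_self _ (div_nonneg (visits_nonneg _ _ _) N.cast_nonneg)
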